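/- **Setting.** An (antiparallel) lock is the two-crossing tangle in which two antiparallel strands clasp; the opposite lock is made of the inverse crossings. A lock diagram is an oriented diagram glued entirely from locks and opposite locks. Each lock has two orientation-compatible planar resolutions, one with coefficient $1$ and one with coefficient $\varphi$ (respectively $\bar\varphi$ for the opposite lock). For a lock diagram $\mathcal L$ with $v$ vertices put $$P^{\mathcal L}=\sum_{\text{the } 2^{v}\text{ resolutions}} D^{a}\varphi^{b}\bar\varphi^{c},$$ where $a$ is the number of closed curves of the resolution and $b$, $c$ are the numbers of locks and of opposite locks that are resolved with coefficient $\varphi$ and $\bar\varphi$. Here $\varphi,\bar\varphi,D$ are elements of a field with $D\neq0$ and $\varphi+\bar\varphi+\varphi\bar\varphi D=0$. This holds for $\varphi=A\{q\}$, $\bar\varphi=-A^{-1}\{q\}$, $D=\{A\}/\{q\}$ with $\{x\}=x-x^{-1}$ (HOMFLY polynomial of the lock diagram in the vertical framing), and for $\varphi=-q$, $\bar\varphi=-q^{-1}$, $D=q+q^{-1}$ (Jones polynomial, without the framing factor, of the precursor diagram, in which every lock is shrunk to a crossing), whenever these values are defined and $D\ne 0$. Let $$\Phi_m=\frac{(1+\varphi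 D)^m-1}{D}\qquad(m\in\mathbb Z).$$ A wheel is a circle that runs antiparallel to the strands, or to the other wheels, with which it is connected by locks; the coefficient-$1$ resolution of these locks disconnects it. An edge of multiplicity $m\in\mathbb Z$ is a chain of $|m|$ parallel locks (opposite locks if $m<0$). A group of wheels $T$ is attached to a strand of a diagram at neighbouring positions, i.e. all locks that connect it with the diagram lie on one segment of the strand that carries no other locks; write $P^{T}$ for the polynomial of the diagram in which this strand is closed up to a circle and everything else is removed. **Claim.** Let $\mathcal L$ be any lock diagram. 1. If one wheel is attached to any strand of $\mathcal L$ by a single edge of multiplicity $m$, the polynomial of the new diagram is $(\Phi_m+D)\,P^{\mathcal L}$. If wheels are attached successively in this way, each one to $\mathcal L$ or to a wheel attached before, by edges of multiplicities $m_1,\dots,m_r$ (a tree of wheels), the polynomial is $\prod_i(\Phi_{m_i}+D)\cdot P^{\mathcal L}$. 2. If two wheels are attached to neighbouring positions of a strand of $\mathcal L$ by one lock each and are connected with each other by one lock, the polynomial is $\big((\varphi+D)^2+\varphi(\Phi_2+D)\big)P^{\mathcal L}$. 3. For three wheels in a row, the first connected with the second and the second with the third by one lock each, attached to neighbouring positions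 of a strand of $\mathcal L$ (all locks being non-opposite): (a) if only the first and the third wheel are attached to the strand, by one lock each, the polynomial is $\big((\varphi+D)^3+\varphi(\varphi+D)^2+\varphi^2(\Phi_2+D)\big)P^{\mathcal L}$; (b) if each of the three wheels is attached to the strand by one lock (in the planar way), the polynomial is $\big((\varphi+D)^3+2\varphi(\varphi+D)(\Phi_2+D)+\varphi^2(\Phi_3+D)\big)P^{\mathcal L}$. 4. Wheels can always be eliminated: if a diagram is obtained from lock diagrams $\mathcal L_1,\dots,\mathcal L_k$ ($k\ge1$) by composition (connected sum along any arcs) and by attaching groups of wheels $T_1,\dots,T_r$ to any strands (including those of wheels attached before), in any order, then its polynomial is $$\prod_{j=1}^{r}\frac{P^{T_j}}{D}\cdot D^{1-k}\cdot\prod_{i=1}^{k}P^{\mathcal L_i}.$$ In particular, for four links, with one group of three wheels as in 3(b), one group of two wheels as in 2, and one wheel on an edge of multiplicity $m$ as in 1, it is $$\big((\varphi+D)^3+2\varphi(\varphi+D)(\Phi_2+D)+\varphi^2(\Phi_3+D)\big)\big((\varphi+D)^2+\varphi(\Phi_2+D)\big)(\Phi_m+D)\,D^{-3}\,P^{\mathcal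 L_1}P^{\mathcal L_2}P^{\mathcal L_3}P^{\mathcal L_4}.$$ -/

import Mathlib

/-- An oriented diagram glued from antiparallel (AP) locks, recorded by its oriented strands.

Both planar resolutions of an AP lock respect the orientation, so a lock has two incoming and two
outgoing ends, and a resolution is one of the two matchings of the incoming ends with the outgoing
ends: the one with coefficient `1` (the unit resolution) and the one with coefficient `φ`
(or `φbar`, for the opposite lock).

* `Arc`: the oriented arcs of the diagram. An arc ends either at a lock or at a bivalent marked
  point; a closed curve that meets no lock is subdivided by at least one marked point.
* `next`: the arc that follows a given arc when every lock is resolved by its unit resolution.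
  Hence the cycles of `next` are the circles (for instance the wheels) that the locks connect.
* `foot (v, false)` and `foot (v, true)`: the two arcs that enter the lock `v`.
* `opposite v`: whether `v` is the opposite lock, made of the inverse crossings.

Vertical and horizontal locks are both covered. All planar diagrams are covered, and nothing below
requires planarity. -/
structure LockDiagram where
  Arc : Type
  Lock : Type
  [fintypeArc : Fintype Arc]
  [decEqArc : DecidableEq Arc]
  [fintypeLock : Fintype Lock]
  [decEqLock : DecidableEq Lock]
  next : Equiv.Perm Arc
  foot : Lock × Bool ↪ Arc
  opposite : Lock → Bool

namespace LockDiagram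

attribute [instance] fintypeArc decEqArc fintypeLock decEqLock

/-- The exchange of the two strands at every lock of `S`. -/
def exchange (L : LockDiagram) (S : Finset L.Lock) : Equiv.Perm L.Arc :=
  Equiv.Perm.viaFintypeEmbedding
    (Equiv.prodCongrRight fun v => if v ∈ S then Equiv.boolNot else Equiv.refl Bool) L.foot

/-- The arc that follows a given arc when the locks of `S` are resolved by the resolution with
coefficient `φ` (`φbar` for opposite locks), and all other locks by the unit resolution. -/
def resolved (L : LockDiagram) (S : Finset L.Lock) : Equiv.Perm L.Arc :=
  L.next * L.exchange S

/-- The number of closed curves of a resolution. -/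
noncomputable def circles (L : LockDiagram) (S : Finset L.Lock) : ℕ :=
  Nat.card (Quotient (Equiv.Perm.SameCycle.setoid (L.resolved S)))

/-- The planar-resolution polynomial `P = ∑ D ^ a * φ ^ b * φbar ^ c` of a lock diagram: the sum
over all `2 ^ v` resolutions, with `a` closed curves, `b` locks and `c` opposite locks resolved by
the resolution that is not the unit one. -/
noncomputable def poly (L : LockDiagram) {K : Type*} [CommRing K] (φ φbar D : K) : K :=
  ∑ S : Finset L.Lock, (∏ v ∈ S, if L.opposite v then φbar else φ) * D ^ L.circles S

/-- The connected sum of `G` and `H` along the arcs `p` and `a`: both arcs are cut, the first piece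
of `p` is joined to the second piece of `a` (the result is called `a`), and the first piece of `a`
to the second piece of `p` (the result is called `p`). -/
def connSum (G : LockDiagram) (p : G.Arc) (H : LockDiagram) (a : H.Arc) : LockDiagram where
  Arc := G.Arc ⊕ H.Arc
  Lock := G.Lock ⊕ H.Lock
  next := Equiv.swap (Sum.inl p) (Sum.inr a) * Equiv.sumCongr G.next H.next
  foot := ⟨fun x => Sum.casesOn x.1 (fun v => Sum.inl (G.foot (v, x.2)))
      (fun v => Sum.inr (H.foot (v, x.2))), by
    rintro ⟨v | v, b⟩ ⟨w | w, c⟩ h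
    · simpa using h
    · simp at h
    · simp at h
    · simpa using h⟩
  opposite := Sum.elim G.opposite H.opposite

end LockDiagram

/-- A group of wheels on a strand: a lock diagram with a base arc. The base arc lies on the circle
that stands for the strand, closed up; the other circles are the wheels. -/
structure WheelGroup where
  diagram : LockDiagram
  base : diagram.Arc

/-- The group of wheels `T` attached to the strand of `L` that contains the arc `a`: this strand is
cut within `a`, and the strand of `T`, opened at its base arc, is inserted there. -/
def WheelGroup.attach (T : WheelGroup) (L : LockDiagram) (a : L.Arc) : LockDiagram :=
  T.diagram.connSum T.base L a

/-- One wheel attached to the strand through an edge of multiplicity `m`, that is, through a chain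
of `|m|` parallel locks (opposite locks for `m < 0`). The locks are passed in the order
`0, …, |m| - 1` along the strand and in the reverse order along the (antiparallel) wheel.
The arcs `Fin.last _` end at a marked point, all others at a lock. -/
def oneWheel (m : ℤ) : WheelGroup where
  diagram :=
    { Arc := Fin (m.natAbs + 1) ⊕ Fin (m.natAbs + 1)
      Lock := Fin m.natAbs
      next := Equiv.sumCongr (finRotate (m.natAbs + 1)) (finRotate (m.natAbs + 1))⁻¹
      foot := ⟨fun x => if x.2 then Sum.inr x.1.castSucc else Sum.inl x.1.castSucc, by
        rintro ⟨v, _ | _⟩ ⟨w, _ | _⟩ h <;> simp_all⟩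
      opposite := fun _ => decide (m < 0) }
  base := Sum.inl (Fin.last _)

/-- A group of wheels whose arcs are those that enter its locks and one more arc, the base arc
`none`, and whose locks are not opposite. -/
def WheelGroup.ofCircles (n : ℕ) (next : Equiv.Perm (Option (Fin n × Bool))) : WheelGroup where
  diagram :=
    { Arc := Option (Fin n × Bool)
      Lock := Fin n
      next := next
      foot := Function.Embedding.some
      opposite := fun _ => false }
  base := none

/-- Two lock-connected wheels at neighbouring positions of the strand. Locks: `0` strand–wheel 1,
`1` strand–wheel 2, `2` wheel 1–wheel 2. The lists are the strand, wheel 1, and wheel 2, each with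
its locks in the order in which it passes them. -/
def twoWheels : WheelGroup :=
  .ofCircles 3
    (List.formPerm [none, some (0, false), some (1, false)]
      * List.formPerm [some (0, true), some (2, false)]
      * List.formPerm [some (1, true), some (2, true)])

/-- A row of three wheels whose two outer ones are attached at neighbouring positions of the strand.
Locks: `0` strand–wheel 1, `1` wheel 1–wheel 2, `2` wheel 2–wheel 3, `3` wheel 3–strand. -/
def threeWheelsCycle : WheelGroup :=
  .ofCircles 4
    (List.formPerm [none, some (0, false), some (3, true)]
      * List.formPerm [some (0, true), some (1, false)]
      * List.formPerm [some (1, true), some (2, false)]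
      * List.formPerm [some (2, true), some (3, false)])

/-- A row of three wheels that are all attached, at neighbouring positions, to the strand.
Locks: `0`, `1`, `2` strand–wheels 1, 2, 3; `3` wheel 1–wheel 2, `4` wheel 2–wheel 3. The cyclic
order `1, 3, 4` on wheel 2 is the planar one. -/
def threeWheelsFan : WheelGroup :=
  .ofCircles 5
    (List.formPerm [none, some (0, false), some (1, false), some (2, false)]
      * List.formPerm [some (0, true), some (3, false)]
      * List.formPerm [some (1, true), some (3, true), some (4, false)]
      * List.formPerm [some (2, true), some (4, true)])

/-- `WheelDiagram G Ts Ls`: the diagram `G` arises from the links `Ls` (counted with multiplicity)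
by composition along arbitrary arcs and by attaching the groups of wheels `Ts` (counted with
multiplicity) to arbitrary strands, those of wheels attached before included, in any order. -/
inductive WheelDiagram : LockDiagram → Multiset WheelGroup → Multiset LockDiagram → Prop
  | link (L : LockDiagram) : WheelDiagram L 0 {L}
  | compose {G H : LockDiagram} {Ts Us : Multiset WheelGroup} {Ls Ms : Multiset LockDiagram}
      (hG : WheelDiagram G Ts Ls) (hH : WheelDiagram H Us Ms) (p : G.Arc) (a : H.Arc) :
      WheelDiagram (G.connSum p H a) (Ts + Us) (Ls + Ms)
  | attach {G : LockDiagram} {Ts : Multiset WheelGroup} {Ls : Multiset LockDiagram}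
      (hG : WheelDiagram G Ts Ls) (T : WheelGroup) (a : G.Arc) :
      WheelDiagram (T.attach G a) (T ::ₘ Ts) Ls

/-- The coefficient `Φ_m = ((1 + φ D) ^ m - 1) / D` of a multiple edge. -/
def chainCoeff {K : Type*} [Field K] (φ D : K) (m : ℤ) : K :=
  ((1 + φ * D) ^ m - 1) / D

/-! A resolution is a permutation of the arcs, and its closed curves are the cycles. Multiplication
by a transposition merges two cycles or splits one. A connected sum multiplies the disjoint sum of
two resolutions by one transposition across the summands, so it always loses exactly one curve
(`connSum_circles`). Summing over pairs of resolutions gives `connSum_poly`: polynomials multiply,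
up to one factor `D`. Attaching a group of wheels is itself a connected sum, with the group on its
closed-up strand, so induction over the construction eliminates all groups (`WheelDiagram.poly_eq`).

It remains to evaluate the groups. For one wheel on a chain, the first exchanged lock merges wheel
and strand and each further one splits off a curve; the binomial theorem then sums all resolutions
(`oneWheel_poly`). The groups of two and three wheels have at most 32 resolutions, which are
enumerated. -/

namespace Equiv.Perm

/-! ### Cycles of a permutation and multiplication by a transposition -/

variable {α β : Type*}

/-- The number of cycles of a permutation, fixed points included. -/
noncomputable def cycleCount (σ : Perm α) : ℕ :=
  Nat.card (Quotient (SameCycle.setoid σ))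

theorem SameCycle.sumCongr_inl {σ : Perm α} {τ : Perm β} {x y : α} (h : σ.SameCycle x y) :
    (sumCongr σ τ).SameCycle (Sum.inl x) (Sum.inl y) := by
  obtain ⟨n, rfl⟩ := h
  have : (sumCongr σ τ) ^ n = sumCongr (σ ^ n) (τ ^ n) :=
    ((map_zpow (sumCongrHom α β) (σ, τ) n)).symm
  exact ⟨n, by simp [this]⟩

theorem SameCycle.sumCongr_inr {σ : Perm α} {τ : Perm β} {x y : β} (h : τ.SameCycle x y) :
    (sumCongr σ τ).SameCycle (Sum.inr x) (Sum.inr y) := by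
  obtain ⟨n, rfl⟩ := h
  have : (sumCongr σ τ) ^ n = sumCongr (σ ^ n) (τ ^ n) :=
    ((map_zpow (sumCongrHom α β) (σ, τ) n)).symm
  exact ⟨n, by simp [this]⟩

theorem sameCycle_sumCongr {σ : Perm α} {τ : Perm β} {x y : α ⊕ β} :
    (sumCongr σ τ).SameCycle x y ↔ Sum.LiftRel σ.SameCycle τ.SameCycle x y := by
  constructor
  · rintro ⟨n, rfl⟩
    have : (sumCongr σ τ) ^ n = sumCongr (σ ^ n) (τ ^ n) :=
      ((map_zpow (sumCongrHom α β) (σ, τ) n)).symm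
    rw [this]
    rcases x with x | x
    · exact Sum.LiftRel.inl ⟨n, rfl⟩
    · exact Sum.LiftRel.inr ⟨n, rfl⟩
  · rintro (h | h)
    · exact h.sumCongr_inl
    · exact h.sumCongr_inr

theorem cycleCount_sumCongr [Finite α] [Finite β] (σ : Perm α) (τ : Perm β) :
    cycleCount (sumCongr σ τ) = cycleCount σ + cycleCount τ := by
  rw [cycleCount, cycleCount, cycleCount, ← Nat.card_sum]
  refine Nat.card_congr ⟨Quotient.lift (Sum.map (Quotient.mk _) (Quotient.mk _)) ?_,
    Sum.elim (Quotient.map Sum.inl fun _ _ h => h.sumCongr_inl)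
      (Quotient.map Sum.inr fun _ _ h => h.sumCongr_inr), ?_, ?_⟩
  · intro x y h
    cases sameCycle_sumCongr.1 h with
    | inl k => exact congrArg Sum.inl (Quotient.sound k)
    | inr k => exact congrArg Sum.inr (Quotient.sound k)
  · rintro ⟨x | x⟩ <;> rfl
  · rintro (q | q) <;> induction q using Quotient.inductionOn <;> rfl

variable [DecidableEq α]

/-- If `x` and `y` lie on different cycles of `σ`, then these are merged in `swap x y * σ`. -/
theorem SameCycle.swap_mul_of_not_sameCycle [Finite α] {σ : Perm α} {x y : α}
    (h : ¬ σ.SameCycle x y) : (swap x y * σ).SameCycle x y := by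
  by_contra hτ
  -- An orbit of `x` that never meets `y` follows `σ` throughout, so it stays on the `σ`-cycle of
  -- `x`.
  have key : ∀ n : ℕ, σ.SameCycle x (((swap x y * σ) ^ n) x) := by
    intro n
    induction n with
    | zero => exact .refl _ _
    | succ n ih =>
      rw [pow_succ', mul_apply]
      set w := ((swap x y * σ) ^ n) x with hw
      have hwy : (swap x y * σ) w ≠ y := fun e =>
        hτ ⟨(n + 1 : ℕ), by rw [zpow_natCast, pow_succ', mul_apply, ← hw, e]⟩
      have hx : σ w ≠ x := fun e => hwy (by simp [e])
      have hy : σ w ≠ y := fun e => h (by rw [← e]; exact sameCycle_apply_right.2 ih)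
      rw [mul_apply, swap_apply_of_ne_of_ne hx hy]
      exact sameCycle_apply_right.2 ih
  -- The orbit does reach the predecessor of `x` under `swap x y * σ`; `σ` sends that point to `y`,
  -- a contradiction.
  obtain ⟨n, hn⟩ := SameCycle.exists_nat_pow_eq
    ((sameCycle_symm_apply_right (f := swap x y * σ)).2 (.refl _ x))
  have h₁ := key n
  rw [hn] at h₁
  refine h ?_
  have h₂ : σ ((swap x y * σ).symm x) = y := by
    have := apply_symm_apply (swap x y * σ) x
    rw [mul_apply, swap_apply_eq_iff] at this
    simpa using this
  rw [← h₂]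
  exact sameCycle_apply_right.2 h₁

/-- If `x` and `y` lie on the same cycle of `σ`, then it is split in `swap x y * σ`. -/
theorem SameCycle.not_sameCycle_swap_mul [Finite α] {σ : Perm α} {x y : α} (hxy : x ≠ y)
    (h : σ.SameCycle x y) : ¬ (swap x y * σ).SameCycle x y := by
  classical
  have hex : ∃ n : ℕ, (σ ^ n) x = y := h.exists_nat_pow_eq
  set j := Nat.find hex with hj
  have hjy : (σ ^ j) x = y := Nat.find_spec hex
  have hmin : ∀ i < j, (σ ^ i) x ≠ y := fun i hi => Nat.find_min hex hi
  have hj0 : 0 < j := Nat.pos_of_ne_zero fun e => hxy (by simpa [e] using hjy)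
  have hret : ∀ i, 0 < i → i < j → (σ ^ i) x ≠ x := by
    intro i hi hij e
    refine hmin (j - i) (by omega) ?_
    rw [← hjy]
    conv_rhs => rw [show j = (j - i) + i by omega, pow_add, mul_apply, e]
  -- With `j` the first time that `σ` takes `x` to `y`, the orbit closes up as `x, σ x, …, σ ^ (j -
  -- 1) x`: the step to `y` is diverted to `x`.
  have key : ∀ n : ℕ, ∃ i < j, ((swap x y * σ) ^ n) x = (σ ^ i) x := by
    intro n
    induction n with
    | zero => exact ⟨0, hj0, by simp⟩
    | succ n ih =>
      obtain ⟨i, hi, e⟩ := ih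
      rw [pow_succ', mul_apply, e, mul_apply, ← mul_apply σ, ← pow_succ']
      rcases eq_or_lt_of_le (Nat.succ_le_of_lt hi) with hij | hij
      · exact ⟨0, hj0, by rw [← Nat.succ_eq_add_one, hij, hjy]; simp⟩
      · exact ⟨i + 1, hij,
          swap_apply_of_ne_of_ne (hret _ (Nat.succ_pos _) hij) (hmin _ hij)⟩
  intro hτ
  obtain ⟨n, hn⟩ := hτ.exists_nat_pow_eq
  obtain ⟨i, hi, e⟩ := key n
  exact hmin i hi (e ▸ hn)

/-- Every cycle of `swap x y * σ` is contained in the union of the cycles of `x` and `y` or is a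
cycle of `σ`. -/
theorem SameCycle.of_swap_mul {σ : Perm α} {x y u w : α} (h : (swap x y * σ).SameCycle u w) :
    σ.SameCycle u w ∨ (σ.SameCycle u x ∨ σ.SameCycle u y) ∧ (σ.SameCycle w x ∨ σ.SameCycle w y) := by
  -- The cycles of `σ` with those of `x` and `y` united: an equivalence relation that every step of
  -- `swap x y * σ` respects.
  let R : Setoid α :=
    { r := fun u w => σ.SameCycle u w ∨
        (σ.SameCycle u x ∨ σ.SameCycle u y) ∧ (σ.SameCycle w x ∨ σ.SameCycle w y)
      iseqv :=
        { refl := fun u => .inl (.refl _ u)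
          symm := by
            rintro u w (h | h)
            · exact .inl h.symm
            · exact .inr h.symm
          trans := by
            rintro u v w (h | ⟨h, h'⟩) (k | ⟨k, k'⟩)
            · exact .inl (h.trans k)
            · exact .inr ⟨k.imp h.trans h.trans, k'⟩
            · exact .inr ⟨h, h'.imp k.symm.trans k.symm.trans⟩
            · exact .inr ⟨h, k'⟩ } }
  have step : ∀ v, R v ((swap x y * σ) v) := by
    intro v
    have hv : σ.SameCycle v (σ v) := sameCycle_apply_right.2 (.refl _ v)
    rw [mul_apply]
    rcases eq_or_ne (σ v) x with hx | hx
    · rw [hx, swap_apply_left]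
      exact .inr ⟨.inl (hx ▸ hv), .inr (.refl _ _)⟩
    · rcases eq_or_ne (σ v) y with hy | hy
      · rw [hy, swap_apply_right]
        exact .inr ⟨.inr (hy ▸ hv), .inl (.refl _ _)⟩
      · rw [swap_apply_of_ne_of_ne hx hy]
        exact .inl hv
  have key : ∀ (n : ℕ) (v : α), R v (((swap x y * σ) ^ n) v) := by
    intro n v
    induction n with
    | zero => exact R.refl _
    | succ n ih =>
      rw [pow_succ', mul_apply]
      exact R.trans ih (step _)
  obtain ⟨n | n, rfl⟩ := h
  · exact key n u
  · have := key (n + 1) (((swap x y * σ) ^ Int.negSucc n) u)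
    rw [zpow_negSucc, ← mul_apply, mul_inv_cancel, one_apply] at this
    rw [zpow_negSucc]
    exact R.symm this

theorem SameCycle.swap_mul_of_sameCycle [Finite α] {σ : Perm α} {x y u w : α}
    (hxy : ¬ σ.SameCycle x y) (h : σ.SameCycle u w) : (swap x y * σ).SameCycle u w := by
  have hm := SameCycle.swap_mul_of_not_sameCycle hxy
  -- `σ` is in turn a transposition times `swap x y * σ`, in which `x` and `y` already share a
  -- cycle; uniting their cycles there adds nothing.
  rw [← swap_mul_self_mul x y σ] at h
  rcases h.of_swap_mul with h | ⟨h | h, k | k⟩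
  · exact h
  · exact h.trans k.symm
  · exact h.trans (hm.trans k.symm)
  · exact h.trans (hm.symm.trans k.symm)
  · exact h.trans k.symm

theorem cycleCount_swap_mul_of_not_sameCycle [Finite α] {σ : Perm α} {x y : α}
    (h : ¬ σ.SameCycle x y) : cycleCount (swap x y * σ) + 1 = cycleCount σ := by
  classical
  set τ := swap x y * σ with hτ
  let q₀ : Quotient (SameCycle.setoid σ) := Quotient.mk _ y
  have hq : ∀ u w, (Quotient.mk (SameCycle.setoid σ) u = Quotient.mk _ w) ↔ σ.SameCycle u w :=
    fun u w => Quotient.eq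
  -- The merged cycle is represented by the old cycle of `x`, so dropping that of `y` leaves a
  -- bijection.
  let f : {q : Quotient (SameCycle.setoid σ) // q ≠ q₀} → Quotient (SameCycle.setoid τ) :=
    fun q => Quotient.map id (fun _ _ k => SameCycle.swap_mul_of_sameCycle h k) q.1
  have hf : Function.Bijective f := by
    constructor
    · rintro ⟨⟨u⟩, hu⟩ ⟨⟨w⟩, hw⟩ e
      have hu' : ¬ σ.SameCycle u y := fun k => hu ((hq _ _).2 k)
      have hw' : ¬ σ.SameCycle w y := fun k => hw ((hq _ _).2 k)
      have e' : τ.SameCycle u w := Quotient.exact e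
      refine Subtype.ext ((hq _ _).2 ?_)
      rcases e'.of_swap_mul with k | ⟨k, l⟩
      · exact k
      · exact (k.resolve_right hu').trans (l.resolve_right hw').symm
    · rintro ⟨u⟩
      by_cases hu : σ.SameCycle u y
      · refine ⟨⟨Quotient.mk _ x, fun k => h ((hq _ _).1 k)⟩, Quotient.sound ?_⟩
        exact (SameCycle.swap_mul_of_not_sameCycle h).trans
          (SameCycle.swap_mul_of_sameCycle h hu).symm
      · exact ⟨⟨Quotient.mk _ u, fun k => hu ((hq _ _).1 k)⟩, rfl⟩
  rw [cycleCount, cycleCount, ← Nat.card_congr (Equiv.ofBijective f hf)]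
  have := Nat.card_congr (Equiv.optionSubtypeNe q₀)
  rw [← this, Finite.card_option]

theorem cycleCount_swap_mul_of_sameCycle [Finite α] {σ : Perm α} {x y : α} (hxy : x ≠ y)
    (h : σ.SameCycle x y) : cycleCount (swap x y * σ) = cycleCount σ + 1 := by
  rw [← cycleCount_swap_mul_of_not_sameCycle (SameCycle.not_sameCycle_swap_mul hxy h),
    swap_mul_self_mul]

end Equiv.Perm

/-! ### Resolutions of a connected sum, and elimination of groups of wheels -/

namespace LockDiagram

open Equiv Equiv.Perm

variable (L G H : LockDiagram)

theorem exchange_foot (S : Finset L.Lock) (v : L.Lock) (b : Bool) :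
    L.exchange S (L.foot (v, b)) = L.foot (v, if v ∈ S then !b else b) := by
  rw [exchange, viaFintypeEmbedding_apply_image]
  by_cases h : v ∈ S <;> simp [h]

theorem exchange_of_ne_foot (S : Finset L.Lock) {x : L.Arc} (hx : ∀ p, L.foot p ≠ x) :
    L.exchange S x = x :=
  viaFintypeEmbedding_apply_notMem_range _ _ (by rintro ⟨p, hp⟩; exact hx p hp)

theorem exchange_empty : L.exchange ∅ = 1 := by
  ext x
  by_cases hx : ∃ p, L.foot p = x
  · obtain ⟨⟨v, b⟩, rfl⟩ := hx
    simp [exchange_foot]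
  · push Not at hx
    exact L.exchange_of_ne_foot ∅ hx

theorem exchange_insert {S : Finset L.Lock} {v : L.Lock} (hv : v ∉ S) :
    L.exchange (insert v S) = L.exchange S * swap (L.foot (v, false)) (L.foot (v, true)) := by
  ext x
  by_cases hx : ∃ p, L.foot p = x
  · obtain ⟨⟨w, b⟩, rfl⟩ := hx
    rcases eq_or_ne w v with rfl | hw
    · cases b <;> simp [exchange_foot, hv]
    · have h : ∀ c, L.foot (w, b) ≠ L.foot (v, c) := fun c e => hw (congrArg Prod.fst (L.foot.injective e))
      rw [mul_apply, swap_apply_of_ne_of_ne (h _) (h _), exchange_foot, exchange_foot]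
      simp [hw]
  · push Not at hx
    rw [mul_apply, swap_apply_of_ne_of_ne (hx _).symm (hx _).symm,
      L.exchange_of_ne_foot _ hx, L.exchange_of_ne_foot _ hx]

/-- Changing the resolution of one lock multiplies the permutation of the arcs by a transposition
of the arcs that leave this lock. -/
theorem resolved_insert {S : Finset L.Lock} {v : L.Lock} (hv : v ∉ S) :
    L.resolved (insert v S) =
      swap (L.resolved S (L.foot (v, false))) (L.resolved S (L.foot (v, true))) *
        L.resolved S := by
  rw [resolved, exchange_insert L hv, ← mul_assoc, ← resolved, mul_swap_eq_swap_mul]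

theorem connSum_exchange {p : G.Arc} {a : H.Arc} (S : Finset G.Lock) (T : Finset H.Lock) :
    (G.connSum p H a).exchange (S.disjSum T) =
      Perm.sumCongr (G.exchange S) (H.exchange T) := by
  refine Equiv.ext fun x => ?_
  by_cases hx : ∃ q, (G.connSum p H a).foot q = x
  · obtain ⟨⟨v | v, b⟩, rfl⟩ := hx
    · refine ((G.connSum p H a).exchange_foot _ _ _).trans
        (Eq.trans ?_ (congrArg Sum.inl (G.exchange_foot S v b).symm))
      exact congrArg (fun c => Sum.inl (G.foot (v, c)))
        (@if_congr _ _ _ (_) (_) _ _ _ _ Finset.inl_mem_disjSum rfl rfl)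
    · refine ((G.connSum p H a).exchange_foot _ _ _).trans
        (Eq.trans ?_ (congrArg Sum.inr (H.exchange_foot T v b).symm))
      exact congrArg (fun c => Sum.inr (H.foot (v, c)))
        (@if_congr _ _ _ (_) (_) _ _ _ _ Finset.inr_mem_disjSum rfl rfl)
  · push Not at hx
    refine ((G.connSum p H a).exchange_of_ne_foot _ hx).trans ?_
    rcases x with x | x
    · refine (congrArg Sum.inl (G.exchange_of_ne_foot S fun q hq => ?_)).symm
      exact hx (Sum.inl q.1, q.2) (congrArg Sum.inl hq)
    · refine (congrArg Sum.inr (H.exchange_of_ne_foot T fun q hq => ?_)).symm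
      exact hx (Sum.inr q.1, q.2) (congrArg Sum.inr hq)

theorem connSum_resolved {p : G.Arc} {a : H.Arc} (S : Finset G.Lock) (T : Finset H.Lock) :
    (G.connSum p H a).resolved (S.disjSum T) =
      (swap (Sum.inl p) (Sum.inr a) * Perm.sumCongr (G.resolved S) (H.resolved T) :
        Perm (G.Arc ⊕ H.Arc)) := by
  refine (congrArg (_ * ·) (connSum_exchange G H S T)).trans ?_
  rw [resolved, resolved, ← Perm.sumCongr_mul, ← mul_assoc]
  rfl

/-- A resolution of a connected sum has one closed curve less than the two resolutions of the
summands together. -/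
theorem connSum_circles {p : G.Arc} {a : H.Arc} (S : Finset G.Lock) (T : Finset H.Lock) :
    (G.connSum p H a).circles (S.disjSum T) + 1 = G.circles S + H.circles T := by
  refine (congrArg (fun σ => cycleCount σ + 1) (connSum_resolved G H S T)).trans ?_
  refine (cycleCount_swap_mul_of_not_sameCycle fun h => ?_).trans (cycleCount_sumCongr _ _)
  -- No cycle of a disjoint sum meets both summands, so the transposition merges.
  cases sameCycle_sumCongr.1 h

/-- The polynomial of a connected sum, up to the factor `D`, is the product of the polynomials. -/
theorem connSum_poly {K : Type*} [CommRing K] (φ φbar D : K) (p : G.Arc) (a : H.Arc) :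
    (G.connSum p H a).poly φ φbar D * D = G.poly φ φbar D * H.poly φ φbar D := by
  have h : (G.connSum p H a).poly φ φbar D = ∑ x : Finset G.Lock × Finset H.Lock,
      ((∏ v ∈ x.1, if G.opposite v then φbar else φ) *
        ∏ v ∈ x.2, if H.opposite v then φbar else φ) *
          D ^ (G.connSum p H a).circles (x.1.disjSum x.2) := by
    refine (Fintype.sum_equiv Finset.sumEquiv.symm.toEquiv _ _ fun x => ?_).symm
    refine congrArg (· * _) ?_
    exact (Finset.prod_disjSum x.1 x.2 fun v => if (G.connSum p H a).opposite v then φbar else φ).symm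
  rw [h, poly, poly, Finset.sum_mul, Fintype.sum_mul_sum, Fintype.sum_prod_type]
  refine Finset.sum_congr rfl fun S _ => Finset.sum_congr rfl fun T _ => ?_
  rw [mul_assoc, ← pow_succ, connSum_circles, pow_add, mul_mul_mul_comm]

end LockDiagram

/-- Groups of wheels on a diagram can be eliminated. -/
theorem WheelGroup.attach_poly {K : Type*} [Field K] {D : K} (hD : D ≠ 0) (φ φbar : K)
    (T : WheelGroup) (L : LockDiagram) (a : L.Arc) :
    (T.attach L a).poly φ φbar D = T.diagram.poly φ φbar D / D * L.poly φ φbar D := by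
  rw [div_mul_eq_mul_div, eq_div_iff hD]
  exact LockDiagram.connSum_poly _ _ φ φbar D _ _

theorem WheelDiagram.poly_eq {K : Type*} [Field K] {D : K} (hD : D ≠ 0) (φ φbar : K)
    {G : LockDiagram} {Ts : Multiset WheelGroup} {Ls : Multiset LockDiagram}
    (h : WheelDiagram G Ts Ls) :
    G.poly φ φbar D =
      (Ts.map fun T => T.diagram.poly φ φbar D / D).prod *
        D ^ (1 - (Ls.card : ℤ)) * (Ls.map fun L => L.poly φ φbar D).prod := by
  induction h with
  | link L => simp
  | @compose G H Ts Us Ls Ms hG hH p a ihG ihH =>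
    -- Each composition costs one factor `D`, and `k` links need `k - 1` compositions.
    have hpow : D ^ (1 - ((Ls + Ms).card : ℤ)) * D =
        D ^ (1 - (Ls.card : ℤ)) * D ^ (1 - (Ms.card : ℤ)) := by
      rw [← zpow_add₀ hD, ← zpow_add_one₀ hD]
      congr 1
      push_cast [Multiset.card_add]
      ring
    apply mul_right_cancel₀ hD
    rw [LockDiagram.connSum_poly, ihG, ihH, Multiset.map_add, Multiset.map_add,
      Multiset.prod_add, Multiset.prod_add, mul_right_comm _ _ D, mul_assoc _ _ D, hpow]
    ring
  | attach hG T a ih =>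
    rw [WheelGroup.attach_poly hD, ih, Multiset.map_cons, Multiset.prod_cons]
    ring

/-! ### One wheel on a multiple edge -/

namespace Equiv.Perm

theorem cycleCount_eq_one {α : Type*} {σ : Perm α} (x : α) (h : ∀ y, σ.SameCycle x y) :
    cycleCount σ = 1 := by
  refine Nat.card_eq_one_iff_exists.2 ⟨Quotient.mk _ x, ?_⟩
  rintro ⟨y⟩
  exact Quotient.sound (h y).symm

theorem sameCycle_finRotate (n : ℕ) (j : Fin (n + 1)) : (finRotate (n + 1)).SameCycle 0 j := by
  induction j using Fin.induction with
  | zero => exact .refl _ _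
  | succ i ih =>
    have := sameCycle_apply_right.2 ih
    rwa [finRotate_apply, Fin.coeSucc_eq_succ] at this

end Equiv.Perm

open Equiv Equiv.Perm in
/-- The permutation of the arcs of `oneWheel m` in a resolution. -/
def oneWheelResolved (m : ℤ) (S : Finset (Fin m.natAbs)) :
    Perm (Fin (m.natAbs + 1) ⊕ Fin (m.natAbs + 1)) :=
  (oneWheel m).diagram.resolved S

namespace oneWheelResolved

open Equiv Equiv.Perm

variable {m : ℤ} {S : Finset (Fin m.natAbs)}

theorem empty : oneWheelResolved m ∅ =
    Perm.sumCongr (finRotate (m.natAbs + 1)) (finRotate (m.natAbs + 1))⁻¹ :=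
  (congrArg (_ * ·) (LockDiagram.exchange_empty (oneWheel m).diagram)).trans (mul_one _)

theorem insert {v : Fin m.natAbs} (hv : v ∉ S) :
    oneWheelResolved m (insert v S) =
      swap (oneWheelResolved m S (.inl v.castSucc)) (oneWheelResolved m S (.inr v.castSucc)) *
        oneWheelResolved m S :=
  LockDiagram.resolved_insert (oneWheel m).diagram hv

theorem apply_inl {j : Fin (m.natAbs + 1)} (hj : ∀ i ∈ S, i.castSucc ≠ j) :
    oneWheelResolved m S (.inl j) = .inl (finRotate _ j) := by
  induction j using Fin.lastCases with
  | last =>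
    refine congrArg (oneWheel m).diagram.next
      (LockDiagram.exchange_of_ne_foot (oneWheel m).diagram S ?_)
    rintro ⟨i, _ | _⟩ h
    · exact i.castSucc_ne_last (Sum.inl.inj h)
    · cases h
  | cast i =>
    have hi : i ∉ S := fun h => hj i h rfl
    exact congrArg (oneWheel m).diagram.next
      ((LockDiagram.exchange_foot (oneWheel m).diagram S i false).trans
        (congrArg (fun b => (oneWheel m).diagram.foot (i, b)) (if_neg hi)))

theorem apply_inr {j : Fin (m.natAbs + 1)} (hj : ∀ i ∈ S, i.castSucc ≠ finRotate _ j) :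
    oneWheelResolved m S (.inr (finRotate _ j)) = .inr j := by
  obtain ⟨k, rfl⟩ := (finRotate _).symm.surjective j
  rw [apply_symm_apply] at hj ⊢
  induction k using Fin.lastCases with
  | last =>
    refine congrArg (oneWheel m).diagram.next
      (LockDiagram.exchange_of_ne_foot (oneWheel m).diagram S ?_)
    rintro ⟨i, _ | _⟩ h
    · cases h
    · exact i.castSucc_ne_last (Sum.inr.inj h)
  | cast i =>
    have hi : i ∉ S := fun h => hj i h rfl
    exact congrArg (oneWheel m).diagram.next
      ((LockDiagram.exchange_foot (oneWheel m).diagram S i true).trans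
        (congrArg (fun b => (oneWheel m).diagram.foot (i, b)) (if_neg hi)))

theorem apply_inl_of_mem {i : Fin m.natAbs} (hi : i ∈ S) :
    oneWheelResolved m S (.inl i.castSucc) = .inr ((finRotate _).symm i.castSucc) := by
  exact congrArg (oneWheel m).diagram.next
    ((LockDiagram.exchange_foot (oneWheel m).diagram S i false).trans
      (congrArg (fun b => (oneWheel m).diagram.foot (i, b)) (if_pos hi)))

theorem sameCycle_inl {j : Fin (m.natAbs + 1)} (hj : ∀ i ∈ S, i.castSucc ≠ j) :
    (oneWheelResolved m S).SameCycle (.inl j) (.inl (finRotate _ j)) := by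
  rw [← apply_inl hj]
  exact sameCycle_apply_right.2 (.refl _ _)

theorem sameCycle_inr {j : Fin (m.natAbs + 1)} (hj : ∀ i ∈ S, i.castSucc ≠ finRotate _ j) :
    (oneWheelResolved m S).SameCycle (.inr j) (.inr (finRotate _ j)) := by
  conv => arg 2; rw [← apply_inr hj]
  exact sameCycle_apply_left.2 (.refl _ _)

/-- Outside the range of the exchanged locks, strand and wheel run undisturbed to or from their
marked arcs. An arc that enters an exchanged lock is reached but not continued. Since the wheel runs
backwards, the weak inequality appears before the first such lock on the strand and after the last
one on the wheel. -/
theorem sameCycle_inl_last_of_le (j : Fin (m.natAbs + 1)) (hj : ∀ i ∈ S, j ≤ i.castSucc) :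
    (oneWheelResolved m S).SameCycle (.inl (Fin.last _)) (.inl j) := by
  induction j using Fin.induction with
  | zero =>
    rw [← finRotate_last]
    exact sameCycle_inl fun i _ => i.castSucc_ne_last
  | succ k ih =>
    have hk : ∀ i ∈ S, k.castSucc < i.castSucc := fun i hi =>
      Fin.castSucc_lt_succ.trans_le (hj i hi)
    have := sameCycle_inl fun i hi => (hk i hi).ne'
    rw [finRotate_apply, Fin.coeSucc_eq_succ] at this
    exact (ih fun i hi => (hk i hi).le).trans this

theorem sameCycle_inr_last_of_lt (j : Fin (m.natAbs + 1)) (hj : ∀ i ∈ S, j < i.castSucc) :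
    (oneWheelResolved m S).SameCycle (.inr (Fin.last _)) (.inr j) := by
  induction j using Fin.induction with
  | zero =>
    rw [← finRotate_last]
    refine sameCycle_inr fun i hi => ?_
    rw [finRotate_last]
    exact (hj i hi).ne'
  | succ k ih =>
    have e : finRotate _ k.castSucc = k.succ := by
      rw [finRotate_apply, Fin.coeSucc_eq_succ]
    have := sameCycle_inr (S := S) (j := k.castSucc) fun i hi => e ▸ (hj i hi).ne'
    rw [e] at this
    exact (ih fun i hi => Fin.castSucc_lt_succ.trans (hj i hi)).trans this

theorem sameCycle_inl_last_of_gt (j : Fin (m.natAbs + 1)) (hj : ∀ i ∈ S, i.castSucc < j) :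
    (oneWheelResolved m S).SameCycle (.inl j) (.inl (Fin.last _)) := by
  induction j using Fin.reverseInduction with
  | last => exact .refl _ _
  | cast k ih =>
    have := sameCycle_inl fun i hi => (hj i hi).ne
    rw [finRotate_apply, Fin.coeSucc_eq_succ] at this
    exact this.trans (ih fun i hi => (hj i hi).trans Fin.castSucc_lt_succ)

theorem sameCycle_inr_last_of_gt (j : Fin (m.natAbs + 1)) (hj : ∀ i ∈ S, i.castSucc ≤ j) :
    (oneWheelResolved m S).SameCycle (.inr j) (.inr (Fin.last _)) := by
  induction j using Fin.reverseInduction with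
  | last => exact .refl _ _
  | cast k ih =>
    have hk : ∀ i ∈ S, i.castSucc < k.succ := fun i hi =>
      (hj i hi).trans_lt Fin.castSucc_lt_succ
    have e : finRotate _ k.castSucc = k.succ := by
      rw [finRotate_apply, Fin.coeSucc_eq_succ]
    have := sameCycle_inr (S := S) (j := k.castSucc) fun i hi => e ▸ (hk i hi).ne
    rw [e] at this
    exact this.trans (ih fun i hi => (hk i hi).le)

/-- From its marked arc the strand reaches the first exchanged lock, crosses to the wheel there, and
returns backwards along it to the wheel's marked arc. -/
theorem sameCycle_last (hS : S.Nonempty) :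
    (oneWheelResolved m S).SameCycle (.inl (Fin.last _)) (.inr (Fin.last _)) := by
  set k := S.min' hS
  have hk : ∀ i ∈ S, k.castSucc ≤ i.castSucc := fun i hi =>
    Fin.castSucc_le_castSucc_iff.2 (S.min'_le i hi)
  have h₁ : (oneWheelResolved m S).SameCycle (.inl (Fin.last _)) (.inl k.castSucc) :=
    sameCycle_inl_last_of_le _ hk
  rw [← sameCycle_apply_right, apply_inl_of_mem (S.min'_mem hS)] at h₁
  refine h₁.trans ?_
  obtain ⟨l, hl⟩ := (finRotate (m.natAbs + 1)).surjective k.castSucc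
  rw [← hl, symm_apply_apply]
  induction l using Fin.lastCases with
  -- The first exchanged lock is lock `0`: the crossing leads directly to the marked arc.
  | last => exact .refl _ _
  | cast l =>
    rw [finRotate_apply, Fin.coeSucc_eq_succ] at hl
    exact (sameCycle_inr_last_of_lt _ fun i hi =>
      Fin.castSucc_lt_succ.trans_le (hl ▸ hk i hi)).symm

theorem cycleCount_empty : cycleCount (oneWheelResolved m ∅) = 2 := by
  rw [empty, cycleCount_sumCongr, cycleCount_eq_one 0 (sameCycle_finRotate _),
    cycleCount_eq_one 0 fun y => sameCycle_inv.2 (sameCycle_finRotate _ y)]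

/-- Locks are exchanged in increasing order. The first exchange merges the two circles. At each
later one, both entering arcs lie beyond all locks exchanged so far, hence on the common curve of
the marked arcs, which is split. -/
theorem cycleCount_of_nonempty (hS : S.Nonempty) :
    cycleCount (oneWheelResolved m S) = S.card := by
  induction S using Finset.induction_on_max with
  | empty => exact absurd hS Finset.not_nonempty_empty
  | insert v S hmax ih =>
    have hv : v ∉ S := fun h => lt_irrefl v (hmax v h)
    rw [insert hv, Finset.card_insert_of_notMem hv]
    rcases S.eq_empty_or_nonempty with rfl | hne
    · refine Nat.add_right_cancel (m := 1) ?_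
      rw [cycleCount_swap_mul_of_not_sameCycle, cycleCount_empty]
      · rfl
      · rw [sameCycle_apply_left, sameCycle_apply_right, empty]
        intro h
        cases sameCycle_sumCongr.1 h
    · have hlt : ∀ i ∈ S, i.castSucc < v.castSucc := fun i hi =>
        Fin.castSucc_lt_castSucc_iff.2 (hmax i hi)
      rw [cycleCount_swap_mul_of_sameCycle, ih hne]
      · exact fun h => Sum.inl_ne_inr ((oneWheelResolved m S).injective h)
      · rw [sameCycle_apply_left, sameCycle_apply_right]
        exact (sameCycle_inl_last_of_gt _ hlt).trans ((sameCycle_last hne).trans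
          (sameCycle_inr_last_of_gt _ fun i hi => (hlt i hi).le).symm)

end oneWheelResolved

theorem oneWheel_poly {K : Type*} [Field K] {φ φbar D : K} (hD : D ≠ 0)
    (h : φ + φbar + φ * φbar * D = 0) (m : ℤ) :
    (oneWheel m).diagram.poly φ φbar D / D = chainCoeff φ D m + D := by
  set c := if m < 0 then φbar else φ with hc
  have hsum : (oneWheel m).diagram.poly φ φbar D =
      ∑ S : Finset (Fin m.natAbs), c ^ S.card * D ^ (oneWheelResolved m S).cycleCount := by
    refine Finset.sum_congr rfl fun S _ => congrArg (· * _) ?_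
    refine (Finset.prod_congr rfl fun v _ => ?_).trans (Finset.prod_const c)
    simp [oneWheel, hc]
  have hpow : (1 + c * D) ^ m.natAbs = (1 + φ * D) ^ m := by
    rcases lt_or_ge m 0 with hm | hm
    · have h1 : (1 + φ * D) * (1 + φbar * D) = 1 := by linear_combination D * h
      obtain ⟨n, rfl⟩ := Int.exists_eq_neg_ofNat hm.le
      rw [hc, if_pos hm, zpow_neg, zpow_natCast, Int.natAbs_neg, Int.natAbs_natCast, ← inv_pow,
        eq_inv_of_mul_eq_one_right h1]
    · obtain ⟨n, rfl⟩ := Int.eq_ofNat_of_zero_le hm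
      rw [hc, if_neg (not_lt.2 hm), zpow_natCast, Int.natAbs_natCast]
  have hbin : ∑ S : Finset (Fin m.natAbs), (c * D) ^ S.card = (1 + φ * D) ^ m := by
    have := Fintype.sum_pow_mul_eq_add_pow (Fin m.natAbs) (c * D) 1
    simp only [one_pow, mul_one, Fintype.card_fin] at this
    rw [this, ← hpow, add_comm]
  -- Only the unit resolution deviates: it has two curves instead of `S.card = 0`.
  have hterm : ∀ S : Finset (Fin m.natAbs), c ^ S.card * D ^ (oneWheelResolved m S).cycleCount =
      (c * D) ^ S.card + if S = ∅ then D ^ 2 - 1 else 0 := by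
    intro S
    rcases S.eq_empty_or_nonempty with rfl | hS
    · simp [oneWheelResolved.cycleCount_empty]
    · rw [oneWheelResolved.cycleCount_of_nonempty hS, mul_pow, if_neg hS.ne_empty, add_zero]
  rw [hsum, Finset.sum_congr rfl fun S _ => hterm S, Finset.sum_add_distrib, hbin,
    Finset.sum_ite_eq' Finset.univ, if_pos (Finset.mem_univ _), chainCoeff]
  field_simp
  ring

/-! ### Groups of two and three wheels, by enumeration of resolutions -/

namespace Equiv.Perm

variable {α : Type*} [Fintype α] [DecidableEq α]

/-- The number of cycles of a permutation of a finite type, in computable form. -/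
def numCycles (σ : Perm α) : ℕ :=
  letI : DecidableRel ((SameCycle.setoid σ).r) := inferInstanceAs (DecidableRel σ.SameCycle)
  @Fintype.card _ (Quotient.fintype (SameCycle.setoid σ))

theorem cycleCount_eq_numCycles (σ : Perm α) : cycleCount σ = numCycles σ :=
  @Nat.card_eq_fintype_card _ (_)

end Equiv.Perm

namespace WheelGroup

open Equiv Equiv.Perm

variable {n : ℕ}

/-- The permutation of the arcs of `WheelGroup.ofCircles n next` in a resolution. -/
def circlesResolved (next : Perm (Option (Fin n × Bool))) (S : Finset (Fin n)) :
    Perm (Option (Fin n × Bool)) :=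
  next * optionCongr (prodCongrRight fun v => if v ∈ S then boolNot else Equiv.refl Bool)

/-- Only the base arc `none` enters no lock, so the exchange has an explicit form that can be
evaluated. -/
theorem ofCircles_exchange (next : Perm (Option (Fin n × Bool))) (S : Finset (Fin n)) :
    (ofCircles n next).diagram.exchange S =
      optionCongr (prodCongrRight fun v => if v ∈ S then boolNot else Equiv.refl Bool) := by
  refine Equiv.ext fun x => ?_
  rcases x with _ | ⟨v, b⟩
  · exact (LockDiagram.exchange_of_ne_foot (ofCircles n next).diagram S (x := none)
      fun q => Option.some_ne_none q).trans (Eq.refl none)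
  · have key : (if v ∈ S then boolNot else Equiv.refl Bool) b = if v ∈ S then !b else b := by
      split_ifs <;> rfl
    exact (LockDiagram.exchange_foot (ofCircles n next).diagram S v b).trans
      (congrArg (fun c => some (v, c)) key.symm)

theorem ofCircles_circles (next : Perm (Option (Fin n × Bool))) (S : Finset (Fin n)) :
    (ofCircles n next).diagram.circles S = numCycles (circlesResolved next S) :=
  (congrArg (fun e : Perm (Option (Fin n × Bool)) => cycleCount (next * e))
    (ofCircles_exchange next S)).trans (cycleCount_eq_numCycles _)

/-- The polynomial of a group of wheels, from the list of the pairs of the number of locks that are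
not resolved by the unit resolution and the number of closed curves. -/
theorem ofCircles_poly {K : Type*} [CommRing K] (φ φbar D : K)
    (next : Perm (Option (Fin n × Bool))) {s : Multiset (ℕ × ℕ)}
    (hs : (Finset.univ : Finset (Finset (Fin n))).val.map (fun S => (S.card,
      numCycles (circlesResolved next S))) = s) :
    (ofCircles n next).diagram.poly φ φbar D = (s.map fun x => φ ^ x.1 * D ^ x.2).sum := by
  rw [← hs, Multiset.map_map]
  refine Finset.sum_congr rfl fun S _ => ?_
  refine congrArg₂ (· * ·) ?_ (congrArg (D ^ ·) (ofCircles_circles next S))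
  exact (Finset.prod_congr rfl fun v _ => if_neg Bool.false_ne_true).trans (Finset.prod_const φ)

end WheelGroup

theorem twoWheels_poly {K : Type*} [Field K] {φ φbar D : K} (hD : D ≠ 0) :
    twoWheels.diagram.poly φ φbar D / D = (φ + D) ^ 2 + φ * (chainCoeff φ D 2 + D) := by
  rw [twoWheels, WheelGroup.ofCircles_poly φ φbar D _
    -- The locks form a triangle on three circles: any two merge everything, the third splits.
    (s := {(0, 3)} + .replicate 3 (1, 2) + .replicate 3 (2, 1) + {(3, 2)}) (by decide +kernel)]
  simp only [Multiset.map_add, Multiset.map_replicate, Multiset.map_singleton, Multiset.sum_add,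
    Multiset.sum_replicate, Multiset.sum_singleton, nsmul_eq_mul, chainCoeff]
  norm_cast
  field_simp
  ring

theorem threeWheelsCycle_poly {K : Type*} [Field K] {φ φbar D : K} (hD : D ≠ 0) :
    threeWheelsCycle.diagram.poly φ φbar D / D =
      (φ + D) ^ 3 + φ * (φ + D) ^ 2 + φ ^ 2 * (chainCoeff φ D 2 + D) := by
  rw [threeWheelsCycle, WheelGroup.ofCircles_poly φ φbar D _
    -- The locks form a 4-cycle on four circles: up to three of them only merge, the fourth splits.
    (s := {(0, 4)} + .replicate 4 (1, 3) + .replicate 6 (2, 2) + .replicate 4 (3, 1) + {(4, 2)})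
    (by decide +kernel)]
  simp only [Multiset.map_add, Multiset.map_replicate, Multiset.map_singleton, Multiset.sum_add,
    Multiset.sum_replicate, Multiset.sum_singleton, nsmul_eq_mul, chainCoeff]
  norm_cast
  field_simp
  ring

theorem threeWheelsFan_poly {K : Type*} [Field K] {φ φbar D : K} (hD : D ≠ 0) :
    threeWheelsFan.diagram.poly φ φbar D / D =
      (φ + D) ^ 3 + 2 * φ * (φ + D) * (chainCoeff φ D 2 + D)
        + φ ^ 2 * (chainCoeff φ D 3 + D) := by
  rw [threeWheelsFan, WheelGroup.ofCircles_poly φ φbar D _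
    -- Of the ten triples of locks, eight are spanning trees and merge all circles; two are
    -- triangles, which leave one outer wheel apart.
    (s := {(0, 4)} + .replicate 5 (1, 3) + .replicate 10 (2, 2) + .replicate 8 (3, 1) +
      .replicate 2 (3, 3) + .replicate 5 (4, 2) + {(5, 3)}) (by decide +kernel)]
  simp only [Multiset.map_add, Multiset.map_replicate, Multiset.map_singleton, Multiset.sum_add,
    Multiset.sum_replicate, Multiset.sum_singleton, nsmul_eq_mul, chainCoeff]
  norm_cast
  field_simp
  ring

/-! ### The theorem, with the HOMFLY and Jones specialisations -/

theorem mainTheorem11 {K : Type*} [Field K] :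
    (∀ φ φbar D : K, D ≠ 0 → φ + φbar + φ * φbar * D = 0 →
      -- a wheel on a single edge of multiplicity `m`, attached to any diagram
      (∀ (L : LockDiagram) (a : L.Arc) (m : ℤ),
        ((oneWheel m).attach L a).poly φ φbar D =
          (chainCoeff φ D m + D) * L.poly φ φbar D) ∧
      -- trees of wheels
      (∀ (L G : LockDiagram) (ms : Multiset ℤ), WheelDiagram G (ms.map oneWheel) {L} →
        G.poly φ φbar D =
          (ms.map fun m => chainCoeff φ D m + D).prod * L.poly φ φbar D) ∧
      -- two lock-connected wheels
      (∀ (L : LockDiagram) (a : L.Arc),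
        (twoWheels.attach L a).poly φ φbar D =
          ((φ + D) ^ 2 + φ * (chainCoeff φ D 2 + D)) * L.poly φ φbar D) ∧
      -- three lock-connected wheels, the outer two of which are attached to the diagram
      (∀ (L : LockDiagram) (a : L.Arc),
        (threeWheelsCycle.attach L a).poly φ φbar D =
          ((φ + D) ^ 3 + φ * (φ + D) ^ 2 + φ ^ 2 * (chainCoeff φ D 2 + D)) *
            L.poly φ φbar D) ∧
      -- three lock-connected wheels, all of which are attached to the diagram
      (∀ (L : LockDiagram) (a : L.Arc),
        (threeWheelsFan.attach L a).poly φ φbar D =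
          ((φ + D) ^ 3 + 2 * φ * (φ + D) * (chainCoeff φ D 2 + D)
            + φ ^ 2 * (chainCoeff φ D 3 + D)) * L.poly φ φbar D) ∧
      -- arbitrary groups of wheels on arbitrary links are eliminated
      (∀ (G : LockDiagram) (Ts : Multiset WheelGroup) (Ls : Multiset LockDiagram),
        WheelDiagram G Ts Ls →
        G.poly φ φbar D =
          (Ts.map fun T => T.diagram.poly φ φbar D / D).prod *
            D ^ (1 - (Ls.card : ℤ)) * (Ls.map fun L => L.poly φ φbar D).prod) ∧
      -- four links with groups of three, two and one wheels
      (∀ (G L₁ L₂ L₃ L₄ : LockDiagram) (m : ℤ),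
        WheelDiagram G {threeWheelsFan, twoWheels, oneWheel m} {L₁, L₂, L₃, L₄} →
        G.poly φ φbar D =
          ((φ + D) ^ 3 + 2 * φ * (φ + D) * (chainCoeff φ D 2 + D)
              + φ ^ 2 * (chainCoeff φ D 3 + D)) *
            ((φ + D) ^ 2 + φ * (chainCoeff φ D 2 + D)) * (chainCoeff φ D m + D) *
            D ^ (-3 : ℤ) *
            (L₁.poly φ φbar D * L₂.poly φ φbar D * L₃.poly φ φbar D * L₄.poly φ φbar D))) ∧
    -- the bipartite HOMFLY values of `φ`, `φbar`, `D` are admissible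
    (∀ A q φ φbar D : K, A ≠ 0 → q ≠ 0 → A - A⁻¹ ≠ 0 → q - q⁻¹ ≠ 0 →
      φ = A * (q - q⁻¹) → φbar = -(A⁻¹ * (q - q⁻¹)) → D = (A - A⁻¹) / (q - q⁻¹) →
      D ≠ 0 ∧ φ + φbar + φ * φbar * D = 0) ∧
    -- so are the values for the Jones polynomial of the precursor diagram
    (∀ q φ φbar D : K, q ≠ 0 → q + q⁻¹ ≠ 0 →
      φ = -q → φbar = -q⁻¹ → D = q + q⁻¹ →
      D ≠ 0 ∧ φ + φbar + φ * φbar * D = 0) := by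
  refine ⟨fun φ φbar D hD h => ⟨?_, ?_, ?_, ?_, ?_, ?_, ?_⟩, ?_, ?_⟩
  · intro L a m
    rw [WheelGroup.attach_poly hD, oneWheel_poly hD h]
  · intro L G ms hG
    rw [hG.poly_eq hD, Multiset.map_map]
    simp [oneWheel_poly hD h]
  · intro L a
    rw [WheelGroup.attach_poly hD, twoWheels_poly hD]
  · intro L a
    rw [WheelGroup.attach_poly hD, threeWheelsCycle_poly hD]
  · intro L a
    rw [WheelGroup.attach_poly hD, threeWheelsFan_poly hD]
  · intro G Ts Ls hG
    exact hG.poly_eq hD φ φbar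
  · intro G L₁ L₂ L₃ L₄ m hG
    rw [hG.poly_eq hD]
    simp only [Multiset.insert_eq_cons, Multiset.map_cons, Multiset.map_singleton,
      Multiset.prod_cons, Multiset.prod_singleton, Multiset.card_cons, Multiset.card_singleton,
      threeWheelsFan_poly hD, twoWheels_poly hD, oneWheel_poly hD h]
    norm_num [mul_assoc]
  · rintro A q φ φbar D hA hq hA' hq' rfl rfl rfl
    refine ⟨div_ne_zero hA' hq', ?_⟩
    have h₁ : (A - A⁻¹) / (q - q⁻¹) * (q - q⁻¹) = A - A⁻¹ := div_mul_cancel₀ _ hq'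
    have h₂ : A * A⁻¹ = 1 := mul_inv_cancel₀ hA
    -- Here `φ + φbar = (q - q⁻¹) * (A - A⁻¹)`, and `φ * φbar * D` is its negative times `A * A⁻¹`.
    linear_combination (-(A * A⁻¹) * (q - q⁻¹)) * h₁ - (q - q⁻¹) * (A - A⁻¹) * h₂
  · rintro q φ φbar D hq hD rfl rfl rfl
    refine ⟨hD, ?_⟩
    linear_combination (q + q⁻¹) * mul_inv_cancel₀ hq
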